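/- Let $K$ be a number field, $\overline K$ an algebraic closure of $K$, and $K_{ab}\subseteq\overline K$ the maximal abelian extension of $K$. Let $E/K$ be an elliptic curve, and let $\sigma\in \mathrm{Gal}(\overline K/K)$ be a complex conjugation automorphism, i.e. an element of order $2$. Write $\overline K^{\sigma}$ for the fixed field of $\sigma$ and $(K_{ab})^{\sigma}=K_{ab}\cap \overline K^{\sigma}$. Then the group $E((K_{ab})^{\sigma})$ has infinite rank, and hence $E(\overline K^{\sigma})$ has infinite rank. Moreover, for every Weierstrass equation $y^2=x^3+ax+b$ of $E$ with $a,b\in K$, there are elements $x_0,x_1,x_2,\ldots$ of $K$ and square roots $y_i\in (K_{ab})^{\sigma}$ of $x_i^3+ax_i+b$ such that each $K_i=K(y_i)$ is a quadratic extension of $K$ (fixed elementwise by $\sigma$), each $K_n$ is linearly disjoint over $K$ from the compositum $K_0\cdots K_{n-1}$, and the points $P_i=(x_i,y_i)$ of the curve $y^2=x^3+ax+b$ over $(K_{ab})^{\sigma}$ are linearly independent over $\mathbb Z$. -/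

import Mathlib

/-- The maximal abelian extension `K_ab` of `K` inside an extension `Kbar` of `K` (in practice an
algebraic closure of `K`): the compositum of all subextensions of `Kbar / K` that are Galois over
`K` with abelian Galois group. -/
def maxAbelianExtension (K Kbar : Type*) [Field K] [Field Kbar] [Algebra K Kbar] :
    IntermediateField K Kbar :=
  sSup {L : IntermediateField K Kbar | IsAbelianGalois K L}

/-- The fixed field `Kbar ^ σ` of a single automorphism `σ ∈ Gal(Kbar/K)`. -/
def fixedFieldOf {K Kbar : Type*} [Field K] [Field Kbar] [Algebra K Kbar]
    (σ : Kbar ≃ₐ[K] Kbar) : IntermediateField K Kbar :=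
  IntermediateField.fixedField (Subgroup.zpowers σ)

/-- The field `(K_ab) ^ σ` of all elements of `K_ab` that are fixed by `σ`. -/
def abFixedFieldOf {K Kbar : Type*} [Field K] [Field Kbar] [Algebra K Kbar]
    (σ : Kbar ≃ₐ[K] Kbar) : IntermediateField K Kbar :=
  maxAbelianExtension K Kbar ⊓ fixedFieldOf σ

/-- The Weierstrass equation `y² = x³ + a x + b`. -/
def shortWeierstrass {K : Type*} [Field K] (a b : K) : WeierstrassCurve K :=
  ⟨0, 0, 0, a, b⟩

/-- An abelian group has infinite rank if it contains linearly independent (over `ℤ`) sets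
of arbitrarily large size; equivalently its tensor product with `ℚ` has infinite dimension. -/
def HasInfiniteRank (A : Type*) [AddCommGroup A] : Prop :=
  Cardinal.aleph0 ≤ Module.rank ℤ A

/-! Write a Weierstrass equation as z² = g(x), with z = 2y + a₁x + a₃ and g(x) = 4x³ + b₂x² + 2b₄x +
b₆. The elements of K that become squares in the fixed field of σ form a subsemiring P that contains
all squares and meets every pair {t, -t} (`squareCone`). Fix a place w above 2. One constructs x₀,
x₁, … in K and places v₀, v₁, … such that (1) g(xₙ) ∈ P, so it has a σ-fixed square root zₙ, which
lies in K_ab because it is quadratic over K; (2) xₙ is w-adically large; (3) g(xₙ) has a pole of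
order 3 at vₙ, while g(xₘ) is a unit at vₙ for m < n.

By (2), doubling strictly increases w(x), because the 4 in the denominator of the duplication
formula is small at w; hence the point Pₙ over xₙ is not torsion (`Dominates.not_isOfFinAddOrder`).
By (3) and Kummer theory, zₙ is not in K(z₀, …, zₙ₋₁) (`notMem_iSup_adjoin_of_valuation`), so some
automorphism fixes P₀, …, Pₙ₋₁ and sends Pₙ to -Pₙ. Subtracting from a relation with top index n its
image under this automorphism leaves 2lₙPₙ = 0, a contradiction (`linearIndependent_int_of_flips`).
-/

/-- For c large in the sense of P, every coefficient of the cubic expanded in powers of u lies in P.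
As c does not depend on u, the valuations of u remain free. -/
lemma exists_forall_cubic_mem {F : Type*} [Field F] [CharZero F] (P : Subsemiring F)
    (hP : ∀ t : F, t ^ 2 ∈ P) (p q r : F) :
    ∃ c : F, ∀ u ∈ P, 4 * (c + u) ^ 3 + p * (c + u) ^ 2 + 2 * q * (c + u) + r ∈ P := by
  have hadd {s t : F} (hs : s ∈ P) (ht : t ∈ P) : s + t ∈ P := add_mem hs ht
  have hmul {s t : F} (hs : s ∈ P) (ht : t ∈ P) : s * t ∈ P := mul_mem hs ht
  have hnat (n : ℕ) : (n : F) ∈ P := natCast_mem P n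
  have hlin (t : F) : t ^ 2 + t + 1 ∈ P := by
    have := hadd (hP (t + 1 / 2)) (hmul (hnat 3) (hP (1 / 2)))
    convert this using 1
    push_cast
    ring
  -- This c dominates -p, -q and -r simultaneously, since t² + t + 1 = (t + 1/2)² + 3(1/2)² is in P.
  set c : F := 1 + p ^ 2 + q ^ 2 + r ^ 2 with hc
  have hc1 : c - 1 ∈ P := by
    convert hadd (hadd (hP p) (hP q)) (hP r) using 1
    rw [hc]; ring
  have hc0 : c ∈ P := by
    convert hadd hc1 (hnat 1) using 1
    push_cast; ring
  have hp : c + p ∈ P := by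
    convert hadd (hadd (hlin p) (hP q)) (hP r) using 1
    rw [hc]; ring
  have hq : c + q ∈ P := by
    convert hadd (hadd (hlin q) (hP p)) (hP r) using 1
    rw [hc]; ring
  have hr : c + r ∈ P := by
    convert hadd (hadd (hlin r) (hP p)) (hP q) using 1
    rw [hc]; ring
  refine ⟨c, fun u hu => ?_⟩
  -- The coefficients 4, 12c + p, 12c² + 2pc + 2q and 4c³ + pc² + 2qc + r, each written with c, c -
  -- 1, c + p, c + q, c + r.
  have h3 := hmul (hnat 4) (hmul hu (hP u))
  have h2 := hmul (hadd (hmul (hnat 11) hc0) hp) (hP u)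
  have h1 := hmul (hadd (hadd (hmul (hmul (hnat 2) hc0) hp) (hmul (hnat 2) hq))
    (hadd (hmul (hnat 8) (hP c)) (hmul (hmul (hnat 2) hc0) hc1))) hu
  have h0 := hadd (hadd (hadd (hmul (hP c) hp) (hmul (hmul (hnat 2) hc0) hq)) hr)
    (hadd (hmul (hmul (hnat 2) (hP c)) hc1) (hmul (hmul hc0 hc1) (hadd hc0 (hnat 1))))
  convert hadd (hadd h3 h2) (hadd h1 h0) using 1
  push_cast
  ring

/-! ### The ordering of K induced by the involution σ. -/

section RealClosed

variable {K Kbar : Type*} [Field K] [Field Kbar] [Algebra K Kbar] {σ : Kbar ≃ₐ[K] Kbar}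

lemma mem_fixedFieldOf_iff {x : Kbar} : x ∈ fixedFieldOf σ ↔ σ x = x := by
  rw [fixedFieldOf, IntermediateField.mem_fixedField_iff]
  refine ⟨fun h => h σ (Subgroup.mem_zpowers σ), fun h τ hτ => ?_⟩
  have : Subgroup.zpowers σ ≤ MulAction.stabilizer (Kbar ≃ₐ[K] Kbar) x := by
    rw [Subgroup.zpowers_le]
    exact h
  exact this hτ

lemma apply_apply_of_orderOf_eq_two (hσ : orderOf σ = 2) (x : Kbar) : σ (σ x) = x := by
  have h : σ ^ 2 = 1 := hσ ▸ pow_orderOf_eq_one σ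
  rw [pow_two] at h
  exact DFunLike.congr_fun h x

lemma sq_ne_neg_one_of_fixed [CharZero Kbar] [IsAlgClosed Kbar] (hσ : orderOf σ = 2) {i : Kbar}
    (hi : i ^ 2 = -1) : σ i = -i := by
  have hσσ := apply_apply_of_orderOf_eq_two hσ
  refine (sq_eq_sq_iff_eq_or_eq_neg.mp (show (σ i) ^ 2 = i ^ 2 by
    rw [← map_pow, hi, map_neg, map_one])).resolve_left fun hfix => ?_
  obtain ⟨z, hz⟩ : ∃ z, σ z ≠ z := by
    by_contra! h
    have : σ = 1 := AlgEquiv.ext h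
    rw [this, orderOf_one] at hσ
    omega
  -- As σ negates w², it maps w to ±iw; if σ fixed i, then σ²w would be i²w = -w.
  obtain ⟨w, hw⟩ := IsAlgClosed.exists_pow_nat_eq (z - σ z) (n := 2) (by norm_num)
  have hw0 : w ≠ 0 := by
    rintro rfl
    exact hz (sub_eq_zero.mp (by rw [← hw]; ring)).symm
  have h1 : (σ w) ^ 2 = (i * w) ^ 2 := by
    rw [← map_pow, hw, map_sub, hσσ, mul_pow, hi, hw]
    ring
  have h2 : σ (σ w) = - w := by
    rcases sq_eq_sq_iff_eq_or_eq_neg.mp h1 with h | h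
    · rw [h, map_mul, hfix, h]
      linear_combination w * hi
    · rw [h, map_neg, map_mul, hfix, h]
      linear_combination w * hi
  rw [hσσ] at h2
  exact hw0 (self_eq_neg.mp h2)

/-- The elements of `K` that are squares in the fixed field of an involution `σ`. -/
def squareCone [CharZero Kbar] [IsAlgClosed Kbar] (hσ : orderOf σ = 2) : Subsemiring K where
  carrier := {d | ∃ r : Kbar, σ r = r ∧ r ^ 2 = algebraMap K Kbar d}
  mul_mem' := by
    rintro a b ⟨r, hr, hra⟩ ⟨s, hs, hsb⟩
    exact ⟨r * s, by rw [map_mul, hr, hs], by rw [mul_pow, hra, hsb, map_mul]⟩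
  one_mem' := ⟨1, by simp, by simp⟩
  zero_mem' := ⟨0, by simp, by simp⟩
  add_mem' := by
    rintro a b ⟨r, hr, hra⟩ ⟨s, hs, hsb⟩
    obtain ⟨i, hi⟩ := IsAlgClosed.exists_pow_nat_eq (-1 : Kbar) (n := 2) (by norm_num)
    obtain ⟨w, hw⟩ := IsAlgClosed.exists_pow_nat_eq (r + i * s) (n := 2) (by norm_num)
    -- r² + s² = (r + is)(r - is) is the norm of w², hence the square of the σ-fixed norm of w.
    refine ⟨w * σ w, by rw [map_mul, apply_apply_of_orderOf_eq_two hσ, mul_comm], ?_⟩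
    rw [mul_pow, ← map_pow, hw, map_add, map_mul, hr, hs, sq_ne_neg_one_of_fixed hσ hi, map_add,
      ← hra, ← hsb]
    linear_combination (-s ^ 2) * hi

lemma mem_squareCone [CharZero Kbar] [IsAlgClosed Kbar] {hσ : orderOf σ = 2} {d : K} :
    d ∈ squareCone hσ ↔ ∃ r : Kbar, σ r = r ∧ r ^ 2 = algebraMap K Kbar d :=
  Iff.rfl

lemma sq_mem_squareCone [CharZero Kbar] [IsAlgClosed Kbar] (hσ : orderOf σ = 2) (t : K) :
    t ^ 2 ∈ squareCone hσ :=
  ⟨algebraMap K Kbar t, by simp, by simp⟩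

lemma mem_or_neg_mem_squareCone [CharZero Kbar] [IsAlgClosed Kbar] (hσ : orderOf σ = 2) (d : K) :
    d ∈ squareCone hσ ∨ -d ∈ squareCone hσ := by
  obtain ⟨r, hr⟩ := IsAlgClosed.exists_pow_nat_eq (algebraMap K Kbar d) (n := 2) (by norm_num)
  rcases sq_eq_sq_iff_eq_or_eq_neg.mp (show (σ r) ^ 2 = r ^ 2 by
    rw [← map_pow, hr, AlgEquiv.commutes]) with h | h
  · exact .inl ⟨r, h, hr⟩
  · obtain ⟨i, hi⟩ := IsAlgClosed.exists_pow_nat_eq (-1 : Kbar) (n := 2) (by norm_num)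
    refine .inr ⟨i * r, ?_, ?_⟩
    · rw [map_mul, sq_ne_neg_one_of_fixed hσ hi, h, neg_mul_neg]
    · rw [mul_pow, hi, hr, map_neg, neg_one_mul]

end RealClosed

open IsDedekindDomain NumberField

/-! ### Places of K avoiding finitely many elements. -/

section Places

variable {K : Type*} [Field K] [NumberField K]

lemma exists_place_valuation_lt_one {p : ℕ} (hp : p.Prime) :
    ∃ v : HeightOneSpectrum (𝓞 K), v.valuation K (p : K) < 1 := by
  have hu : ¬ IsUnit (p : 𝓞 K) := by
    intro h
    have := h.map (Algebra.norm ℤ)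
    rw [show (p : 𝓞 K) = algebraMap ℤ (𝓞 K) p by simp, Algebra.norm_algebraMap,
      isUnit_pow_iff Module.finrank_pos.ne', Int.isUnit_iff] at this
    have := hp.two_le
    omega
  obtain ⟨M, hM, hpM⟩ := exists_max_ideal_of_mem_nonunits (a := (p : 𝓞 K)) hu
  have hp0 : (p : 𝓞 K) ≠ 0 := by exact_mod_cast hp.ne_zero
  refine ⟨⟨M, hM.isPrime, fun h => hp0 (by simpa [h] using hpM)⟩, ?_⟩
  have := (HeightOneSpectrum.valuation_lt_one_iff_mem (K := K)
    ⟨M, hM.isPrime, fun h => hp0 (by simpa [h] using hpM)⟩ (p : 𝓞 K)).mpr hpM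
  simpa using this

/-- Each rational prime has a place above it, and a Bézout relation shows that two distinct primes
share none. -/
lemma infinite_heightOneSpectrum : Infinite (HeightOneSpectrum (𝓞 K)) := by
  choose v hv using fun p : Nat.Primes => exists_place_valuation_lt_one (K := K) p.2
  refine Infinite.of_injective v fun p q hpq => ?_
  by_contra hne
  have hcop : IsCoprime (p : ℤ) (q : ℤ) :=
    Nat.isCoprime_iff_coprime.mpr ((Nat.coprime_primes p.2 q.2).mpr fun h => hne (Subtype.ext h))
  obtain ⟨a, b, hab⟩ := hcop
  have hint (n : ℤ) : (v p).valuation K (n : K) ≤ 1 := by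
    simpa using (v p).valuation_le_one (K := K) (n : 𝓞 K)
  have h : (v p).valuation K ((a : K) * (p : ℕ) + (b : K) * (q : ℕ)) < 1 := by
    refine Valuation.map_add_lt _ ?_ ?_
    · rw [map_mul]
      exact mul_lt_one_of_nonneg_of_lt_one_right (hint a) zero_le (hv p)
    · rw [map_mul]
      refine mul_lt_one_of_nonneg_of_lt_one_right (hint b) zero_le (hpq ▸ hv q)
  have h1 : ((a : K) * (p : ℕ) + (b : K) * (q : ℕ)) = 1 := by
    exact_mod_cast congrArg (Int.cast (R := K)) hab
  rw [h1, map_one] at h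
  exact lt_irrefl _ h

lemma exists_place_forall_valuation_eq_one (S : Finset K) :
    ∃ v : HeightOneSpectrum (𝓞 K), ∀ s ∈ S, s ≠ 0 → v.valuation K s = 1 := by
  have := infinite_heightOneSpectrum (K := K)
  have hfin : (⋃ s ∈ S, HeightOneSpectrum.Support (𝓞 K) s ∪
      HeightOneSpectrum.Support (𝓞 K) s⁻¹).Finite :=
    S.finite_toSet.biUnion fun s _ =>
      (HeightOneSpectrum.Support.finite _ s).union (HeightOneSpectrum.Support.finite _ s⁻¹)
  obtain ⟨v, hv⟩ := hfin.infinite_compl.nonempty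
  refine ⟨v, fun s hs hs0 => ?_⟩
  simp only [Set.mem_compl_iff, Set.mem_iUnion, not_exists, Set.mem_union, not_or] at hv
  obtain ⟨h1, h2⟩ := hv s hs
  have h1 : v.valuation K s ≤ 1 := not_lt.mp h1
  have h2 : v.valuation K s⁻¹ ≤ 1 := not_lt.mp h2
  rw [map_inv₀] at h2
  exact le_antisymm h1 ((inv_le_one₀ (by simpa [zero_lt_iff] using hs0)).mp h2)

end Places

/-! ### Valuation estimates for g(x) and for the duplication formula. -/

/-- `x` is large enough with respect to the valuation `w`, compared with the invariants
`b₂, b₄, b₆, b₈` of `W`, for the leading terms of the duplication formula to be dominant. -/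
def WeierstrassCurve.Dominates {K Γ₀ : Type*} [Field K] [LinearOrderedCommGroupWithZero Γ₀]
    (W : WeierstrassCurve K) (w : Valuation K Γ₀) (x : K) : Prop :=
  1 < w x ∧ w W.b₂ < w (4 * x) ∧ w W.b₄ < w (4 * x) ∧ w W.b₆ < w (4 * x) ∧ w W.b₈ < w (4 * x)

/-- The right hand side of the equation `z² = 4x³ + b₂x² + 2b₄x + b₆`, where
`z = 2y + a₁x + a₃`. -/
def WeierstrassCurve.twoTorsionEval {K : Type*} [Field K] (W : WeierstrassCurve K) (x : K) : K :=
  4 * x ^ 3 + W.b₂ * x ^ 2 + 2 * W.b₄ * x + W.b₆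

/-- Comparing the coefficients with 4x rather than x keeps 4x³ dominant even where 4 is small. This
serves both at the place above 2 and at the places vₙ. -/
lemma Valuation.map_cubic_of_lt {K Γ₀ : Type*} [Field K] [LinearOrderedCommGroupWithZero Γ₀]
    (w : Valuation K Γ₀) (w2 : w 2 ≤ 1) {p q r x : K} (h1 : 1 < w x) (hp : w p < w (4 * x))
    (hq : w q < w (4 * x)) (hr : w r < w (4 * x)) :
    w (4 * x ^ 3 + p * x ^ 2 + 2 * q * x + r) = w (4 * x) * w x ^ 2 := by
  have hx : 0 < w x := zero_lt_one.trans h1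
  have h4 : 0 < w (4 * x) := zero_le.trans_lt hp
  have e : w (4 * x ^ 3) = w (4 * x) * w x ^ 2 := by
    rw [← map_pow, ← map_mul]; congr 1; ring
  have l2 : w (p * x ^ 2) < w (4 * x ^ 3) := by
    rw [e, map_mul, map_pow]
    exact mul_lt_mul_of_pos_right hp (pow_pos hx 2)
  have l1 : w (2 * q * x) < w (4 * x ^ 3) := by
    rw [e, map_mul, map_mul]
    calc w 2 * w q * w x ≤ 1 * w q * w x := by gcongr
      _ = w q * w x ^ 1 := by rw [one_mul, pow_one]
      _ < w (4 * x) * w x ^ 2 := mul_lt_mul'' hq (pow_lt_pow_right₀ h1 (by norm_num)) zero_le zero_le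
  have l0 : w r < w (4 * x ^ 3) := by
    rw [e]
    calc w r = w r * 1 := (mul_one _).symm
      _ < w (4 * x) * w x ^ 2 := mul_lt_mul'' hr (one_lt_pow₀ h1 (by norm_num)) zero_le zero_le
  rw [← e, add_assoc, add_assoc]
  exact w.map_add_eq_of_lt_left (w.map_add_lt l2 (w.map_add_lt l1 l0))

namespace WeierstrassCurve.Dominates

variable {K Γ₀ : Type*} [Field K] [LinearOrderedCommGroupWithZero Γ₀] {W : WeierstrassCurve K}
  {w : Valuation K Γ₀} {x : K}

lemma valuation_twoTorsionEval (h : W.Dominates w x) (w2 : w 2 ≤ 1) :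
    w (W.twoTorsionEval x) = w (4 * x) * w x ^ 2 :=
  w.map_cubic_of_lt w2 h.1 h.2.1 h.2.2.1 h.2.2.2.1

lemma twoTorsionEval_ne_zero (h : W.Dominates w x) (w2 : w 2 ≤ 1) : W.twoTorsionEval x ≠ 0 := by
  rw [← w.ne_zero_iff, h.valuation_twoTorsionEval w2]
  exact mul_ne_zero (zero_le.trans_lt h.2.1).ne' (pow_ne_zero _ (zero_lt_one.trans h.1).ne')

lemma of_lt {x' : K} (h : W.Dominates w x) (hx : w x < w x') : W.Dominates w x' := by
  have h4 : w (4 * x) ≤ w (4 * x') := by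
    rw [map_mul, map_mul]
    gcongr
  exact ⟨h.1.trans hx, h.2.1.trans_le h4, h.2.2.1.trans_le h4, h.2.2.2.1.trans_le h4,
    h.2.2.2.2.trans_le h4⟩

/-- The leading terms give x⁴ / 4x³ = x/4, and dividing by 4 increases the valuation above 2. -/
lemma lt_valuation_duplication (h : W.Dominates w x) (w2 : w 2 < 1) :
    w x < w ((x ^ 4 - W.b₄ * x ^ 2 - 2 * W.b₆ * x - W.b₈) / W.twoTorsionEval x) := by
  have h1 := h.1
  have hx : 0 < w x := zero_lt_one.trans h1
  have w4 : w 4 < 1 := by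
    rw [show (4 : K) = 2 * 2 by norm_num, map_mul]
    exact mul_lt_one_of_nonneg_of_lt_one_right w2.le zero_le w2
  have h4x : w (4 * x) < w x := by
    rw [map_mul]
    calc w 4 * w x < 1 * w x := by gcongr
      _ = w x := one_mul _
  have e : w (x ^ 4) = w x * w x ^ 3 := by rw [map_pow, pow_succ']
  have l2 : w (W.b₄ * x ^ 2) < w (x ^ 4) := by
    rw [e, map_mul, map_pow]
    exact mul_lt_mul'' (h.2.2.1.trans h4x) (pow_lt_pow_right₀ h1 (by norm_num)) zero_le zero_le
  have l1 : w (2 * W.b₆ * x) < w (x ^ 4) := by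
    rw [e, map_mul, map_mul]
    calc w 2 * w W.b₆ * w x ≤ 1 * w W.b₆ * w x := by gcongr
      _ = w W.b₆ * w x ^ 1 := by rw [one_mul, pow_one]
      _ < w x * w x ^ 3 := mul_lt_mul'' (h.2.2.2.1.trans h4x)
        (pow_lt_pow_right₀ h1 (by norm_num)) zero_le zero_le
  have l0 : w W.b₈ < w (x ^ 4) := by
    rw [e]
    calc w W.b₈ = w W.b₈ * 1 := (mul_one _).symm
      _ < w x * w x ^ 3 := mul_lt_mul'' (h.2.2.2.2.trans h4x)
        (one_lt_pow₀ h1 (by norm_num)) zero_le zero_le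
  have hnum : w (x ^ 4 - W.b₄ * x ^ 2 - 2 * W.b₆ * x - W.b₈) = w x ^ 4 := by
    rw [sub_sub, sub_sub, w.map_sub_eq_of_lt_left (w.map_add_lt l2 (w.map_add_lt l1 l0)), map_pow]
  rw [map_div₀, hnum, lt_div_iff₀ (by
    rw [zero_lt_iff, w.ne_zero_iff]; exact h.twoTorsionEval_ne_zero w2.le),
    h.valuation_twoTorsionEval w2.le]
  calc w x * (w (4 * x) * w x ^ 2) = w (4 * x) * w x ^ 3 := by rw [pow_succ' (w x) 2, mul_left_comm]
    _ < w x * w x ^ 3 := mul_lt_mul_of_pos_right h4x (pow_pos hx 3)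
    _ = w x ^ 4 := (pow_succ' _ _).symm

end WeierstrassCurve.Dominates

-- One step of the construction: x = c + u, with c from `exists_forall_cubic_mem` and u ∈ P having a
-- simple pole at a fresh place v and a large value at w.
open WithZero in
lemma exists_dominates_valuation_twoTorsionEval {K : Type*} [Field K] [NumberField K]
    (W : WeierstrassCurve K) (P : Subsemiring K) (hsq : ∀ t : K, t ^ 2 ∈ P)
    (htot : ∀ t : K, t ∈ P ∨ -t ∈ P) {w : HeightOneSpectrum (𝓞 K)} (w2 : w.valuation K 2 < 1)
    (S : Finset K) :
    ∃ (x : K) (v : HeightOneSpectrum (𝓞 K)), W.twoTorsionEval x ∈ P ∧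
      W.Dominates (w.valuation K) x ∧ v.valuation K (W.twoTorsionEval x) = exp (3 : ℤ) ∧
      ∀ s ∈ S, s ≠ 0 → v.valuation K s = 1 := by
  classical
  obtain ⟨c, hc⟩ := exists_forall_cubic_mem P hsq W.b₂ W.b₄ W.b₆
  obtain ⟨v, hv⟩ := exists_place_forall_valuation_eq_one (S ∪ {2, c, W.b₂, W.b₄, W.b₆})
  have hle (s : K) (hs : s ∈ ({2, c, W.b₂, W.b₄, W.b₆} : Finset K)) : v.valuation K s ≤ 1 := by
    rcases eq_or_ne s 0 with rfl | hs0
    · simp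
    · exact (hv s (Finset.mem_union_right _ hs) hs0).le
  have v2 : v.valuation K 2 = 1 := hv 2 (by simp) two_ne_zero
  have h42 : (4 : K) = 2 * 2 := by norm_num
  have v4 : v.valuation K 4 = 1 := by rw [h42, map_mul, v2, one_mul]
  have w4 : w.valuation K 4 ≤ 1 := by
    rw [h42, map_mul]
    exact mul_le_one' w2.le w2.le
  have w40 : w.valuation K 4 ≠ 0 := (Valuation.ne_zero_iff _).mpr (by norm_num)
  obtain ⟨π, hπ⟩ := v.valuation_exists_uniformizer K
  have hπ0 : π ≠ 0 := by
    rintro rfl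
    rw [map_zero] at hπ
    exact exp_ne_zero hπ.symm
  have wπ : w.valuation K π ≠ 0 := (Valuation.ne_zero_iff _).mpr hπ0
  obtain ⟨M, hM1, hMc, hM2, hM4, hM6, hM8⟩ : ∃ M, 1 ≤ M ∧ w.valuation K c ≤ M ∧
      w.valuation K W.b₂ ≤ M ∧ w.valuation K W.b₄ ≤ M ∧ w.valuation K W.b₆ ≤ M ∧
      w.valuation K W.b₈ ≤ M := by
    refine ⟨1 ⊔ w.valuation K c ⊔ w.valuation K W.b₂ ⊔ w.valuation K W.b₄ ⊔
      w.valuation K W.b₆ ⊔ w.valuation K W.b₈, ?_⟩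
    simp only [le_sup_iff, le_refl, true_or, or_true, and_self]
  have hM0 : M ≠ 0 := (zero_lt_one.trans_le hM1).ne'
  obtain ⟨k, hk⟩ := exists_pow_lt₀ w2
    (Units.mk0 (w.valuation K 4 / (w.valuation K π * M)) (div_ne_zero w40 (mul_ne_zero wπ hM0)))
  rw [Units.val_mk0, lt_div_iff₀ (zero_lt_iff.mpr (mul_ne_zero wπ hM0))] at hk
  -- The factor π⁻¹ gives the simple pole at v; the factor 2⁻ᵏ makes t large at w and is a unit at
  -- v.
  set t : K := (π * 2 ^ k)⁻¹ with ht
  have hwt : M < w.valuation K 4 * w.valuation K t := by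
    rw [ht, map_inv₀, map_mul, map_pow, ← div_eq_mul_inv, lt_div_iff₀ (zero_lt_iff.mpr
      (mul_ne_zero wπ (pow_ne_zero _ ((Valuation.ne_zero_iff _).mpr two_ne_zero))))]
    calc _ = w.valuation K 2 ^ k * (w.valuation K π * M) := by
          rw [mul_comm, mul_assoc, mul_left_comm]
      _ < _ := hk
  have hwt' : M < w.valuation K t :=
    hwt.trans_le (mul_le_of_le_one_left' w4)
  have hvt : v.valuation K t = exp (1 : ℤ) := by
    rw [ht, map_inv₀, map_mul, map_pow, v2, one_pow, mul_one, hπ, ← exp_neg, neg_neg]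
  obtain ⟨u, huP, hwu, hvu⟩ : ∃ u ∈ P, w.valuation K u = w.valuation K t ∧
      v.valuation K u = v.valuation K t := by
    -- Changing the sign of t puts it in P without affecting any valuation.
    rcases htot t with h | h
    · exact ⟨t, h, rfl, rfl⟩
    · exact ⟨-t, h, Valuation.map_neg _ _, Valuation.map_neg _ _⟩
  have hwx : w.valuation K (c + u) = w.valuation K t := by
    rw [← hwu]
    exact Valuation.map_add_eq_of_lt_right _ (hMc.trans_lt (hwu ▸ hwt'))
  have h1exp : (1 : ℤᵐ⁰) < exp (1 : ℤ) := by
    rw [← exp_zero, exp_lt_exp]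
    norm_num
  have hvx : v.valuation K (c + u) = exp (1 : ℤ) := by
    rw [← hvt, ← hvu]
    exact Valuation.map_add_eq_of_lt_right _
      ((hle c (by simp)).trans_lt (by rw [hvu, hvt]; exact h1exp))
  have hw4x : M < w.valuation K (4 * (c + u)) := by rwa [map_mul, hwx]
  have hv4x : v.valuation K (4 * (c + u)) = exp (1 : ℤ) := by rw [map_mul, v4, one_mul, hvx]
  refine ⟨c + u, v, hc u huP, ⟨hM1.trans_lt (hwx ▸ hwt'), hM2.trans_lt hw4x, hM4.trans_lt hw4x,
    hM6.trans_lt hw4x, hM8.trans_lt hw4x⟩, ?_, fun s hs => hv s (Finset.mem_union_left _ hs)⟩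
  rw [WeierstrassCurve.twoTorsionEval, Valuation.map_cubic_of_lt _ v2.le (hvx ▸ h1exp)
    ((hle _ (by simp)).trans_lt (hv4x ▸ h1exp)) ((hle _ (by simp)).trans_lt (hv4x ▸ h1exp))
    ((hle _ (by simp)).trans_lt (hv4x ▸ h1exp)), hv4x, hvx, ← exp_nsmul, ← exp_add]
  norm_num

open WithZero in
lemma exists_seq_dominates_valuation_twoTorsionEval {K : Type*} [Field K] [NumberField K]
    (W : WeierstrassCurve K) (P : Subsemiring K) (hsq : ∀ t : K, t ^ 2 ∈ P)
    (htot : ∀ t : K, t ∈ P ∨ -t ∈ P) {w : HeightOneSpectrum (𝓞 K)} (w2 : w.valuation K 2 < 1) :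
    ∃ (x : ℕ → K) (v : ℕ → HeightOneSpectrum (𝓞 K)), (∀ n, W.twoTorsionEval (x n) ∈ P) ∧
      (∀ n, W.Dominates (w.valuation K) (x n)) ∧
      (∀ n, (v n).valuation K (W.twoTorsionEval (x n)) = exp (3 : ℤ)) ∧
      ∀ m n, m < n → (v n).valuation K (W.twoTorsionEval (x m)) = 1 := by
  classical
  obtain ⟨f, hf, hf'⟩ := exists_seq_of_forall_finset_exists
    (fun a : K × HeightOneSpectrum (𝓞 K) => W.twoTorsionEval a.1 ∈ P ∧
      W.Dominates (w.valuation K) a.1 ∧ a.2.valuation K (W.twoTorsionEval a.1) = exp (3 : ℤ))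
    (fun a a' => a'.2.valuation K (W.twoTorsionEval a.1) = 1) fun S hS => by
      obtain ⟨x, v, h1, h2, h3, h4⟩ := exists_dominates_valuation_twoTorsionEval W P hsq htot w2
        (S.image fun a => W.twoTorsionEval a.1)
      exact ⟨(x, v), ⟨h1, h2, h3⟩, fun a ha => h4 _ (Finset.mem_image_of_mem _ ha)
        ((hS a ha).2.1.twoTorsionEval_ne_zero w2.le)⟩
  exact ⟨fun n => (f n).1, fun n => (f n).2, fun n => (hf n).1, fun n => (hf n).2.1,
    fun n => (hf n).2.2, hf'⟩

/-! ### Kummer theory for towers of square roots. -/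

section Kummer

variable {K L : Type*} [Field K] [Field L] [Algebra K L]

lemma exists_add_mul_of_mem_sup_adjoin_of_sq_mem {F : IntermediateField K L} {z ε : L}
    (hz : z ^ 2 ∈ F) (hε : ε ∈ F ⊔ IntermediateField.adjoin K {z}) :
    ∃ u ∈ F, ∃ v ∈ F, ε = u + v * z := by
  by_cases hzF : z ∈ F
  · rw [sup_eq_left.mpr (by simpa [IntermediateField.adjoin_le_iff] using hzF)] at hε
    exact ⟨ε, hε, 0, F.zero_mem, by simp⟩
  let E : IntermediateField K L :=
    { carrier := {ε | ∃ u ∈ F, ∃ v ∈ F, ε = u + v * z}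
      mul_mem' := by
        rintro _ _ ⟨u, hu, v, hv, rfl⟩ ⟨u', hu', v', hv', rfl⟩
        exact ⟨u * u' + v * v' * z ^ 2, F.add_mem (F.mul_mem hu hu')
          (F.mul_mem (F.mul_mem hv hv') hz), u * v' + v * u',
          F.add_mem (F.mul_mem hu hv') (F.mul_mem hv hu'), by ring⟩
      add_mem' := by
        rintro _ _ ⟨u, hu, v, hv, rfl⟩ ⟨u', hu', v', hv', rfl⟩
        exact ⟨u + u', F.add_mem hu hu', v + v', F.add_mem hv hv', by ring⟩
      algebraMap_mem' := fun r => ⟨_, F.algebraMap_mem r, 0, F.zero_mem, by simp⟩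
      inv_mem' := by
        rintro _ ⟨u, hu, v, hv, rfl⟩
        by_cases h0 : u + v * z = 0
        · exact ⟨0, F.zero_mem, 0, F.zero_mem, by simp [h0]⟩
        -- The conjugate is nonzero because z ∉ F, so the inverse is obtained by rationalising the
        -- denominator.
        have h1 : u - v * z ≠ 0 := by
          intro h
          by_cases hv0 : v = 0
          · subst hv0
            exact h0 (by simpa using h)
          · exact hzF ((eq_div_of_mul_eq hv0 (by linear_combination -h) : z = u / v) ▸
              F.div_mem hu hv)
        have h2 : u ^ 2 - v ^ 2 * z ^ 2 ≠ 0 := by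
          rw [show u ^ 2 - v ^ 2 * z ^ 2 = (u + v * z) * (u - v * z) by ring]
          exact mul_ne_zero h0 h1
        have hm : u ^ 2 - v ^ 2 * z ^ 2 ∈ F :=
          F.sub_mem (pow_mem hu 2) (F.mul_mem (pow_mem hv 2) hz)
        refine ⟨u / (u ^ 2 - v ^ 2 * z ^ 2), F.div_mem hu hm, -v / (u ^ 2 - v ^ 2 * z ^ 2),
          F.div_mem (F.neg_mem hv) hm, ?_⟩
        field_simp
        ring }
  have hle : F ⊔ IntermediateField.adjoin K {z} ≤ E := by
    refine sup_le (fun a ha => ⟨a, ha, 0, F.zero_mem, by simp⟩) ?_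
    rw [IntermediateField.adjoin_le_iff, Set.singleton_subset_iff]
    exact ⟨0, F.zero_mem, 1, F.one_mem, by simp⟩
  exact hle hε

lemma iSup_fin_succ_eq_sup {α : Type*} [CompleteLattice α] (f : ℕ → α) (n : ℕ) :
    (⨆ i : Fin (n + 1), f i) = (⨆ i : Fin n, f i) ⊔ f n := by
  refine le_antisymm (iSup_le fun i => ?_) (sup_le (iSup_le fun i => ?_) ?_)
  · rcases Nat.lt_succ_iff_lt_or_eq.mp i.2 with h | h
    · exact le_sup_of_le_left (le_iSup (fun i : Fin n => f i) ⟨i, h⟩)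
    · rw [h]; exact le_sup_right
  · exact le_iSup (fun i : Fin (n + 1) => f i) i.castSucc
  · exact le_iSup (fun i : Fin (n + 1) => f i) (Fin.last n)

lemma exists_isSquare_mul_prod_of_mem_iSup_adjoin [CharZero L] {z : ℕ → L} {d : ℕ → K}
    (hz : ∀ n, z n ^ 2 = algebraMap K L (d n)) (n : ℕ) (e : K) (ε : L)
    (hε : ε ^ 2 = algebraMap K L e)
    (hmem : ε ∈ ⨆ i : Fin n, IntermediateField.adjoin K {z i}) :
    ∃ S ⊆ Finset.range n, IsSquare (e * ∏ i ∈ S, d i) := by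
  induction n generalizing e ε with
  | zero =>
    rw [iSup_of_empty, IntermediateField.mem_bot] at hmem
    obtain ⟨a, rfl⟩ := hmem
    refine ⟨∅, by simp, a, ?_⟩
    rw [Finset.prod_empty, mul_one, ← pow_two]
    exact ((algebraMap K L).injective (by rw [map_pow, hε])).symm
  | succ n ih =>
    rw [iSup_fin_succ_eq_sup fun i => IntermediateField.adjoin K {z i}] at hmem
    set F := ⨆ i : Fin n, IntermediateField.adjoin K {z i} with hF
    have hmono : Finset.range n ⊆ Finset.range (n + 1) := Finset.range_mono n.le_succ
    have hzF : z n ^ 2 ∈ F := hz n ▸ F.algebraMap_mem _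
    obtain ⟨u, hu, v, hv, rfl⟩ := exists_add_mul_of_mem_sup_adjoin_of_sq_mem hzF hmem
    by_cases hznF : z n ∈ F
    · obtain ⟨S, hS, h⟩ := ih e _ hε (F.add_mem hu (F.mul_mem hv hznF))
      exact ⟨S, hS.trans hmono, h⟩
    -- Since (u + v zₙ)² ∈ K, the cross term 2uv zₙ lies in F, which would put zₙ in F if uv ≠ 0.
    have huv : u = 0 ∨ v = 0 := by
      by_contra! h
      have hm : 2 * u * v ∈ F := F.mul_mem (F.mul_mem (ofNat_mem F 2) hu) hv
      refine hznF ((eq_div_of_mul_eq (mul_ne_zero (mul_ne_zero two_ne_zero h.1) h.2) ?_ :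
        z n = (algebraMap K L e - u ^ 2 - v ^ 2 * z n ^ 2) / (2 * u * v)) ▸ F.div_mem ?_ hm)
      · rw [← hε]; ring
      · exact F.sub_mem (F.sub_mem (F.algebraMap_mem e) (pow_mem hu 2))
          (F.mul_mem (pow_mem hv 2) hzF)
    rcases huv with rfl | rfl
    -- Here ε = v zₙ, so ε zₙ lies in F and its square is e dₙ.
    · obtain ⟨S, hS, h⟩ := ih (e * d n) (v * z n ^ 2) (by rw [map_mul, ← hε, ← hz]; ring)
        (F.mul_mem hv hzF)
      have hnS : n ∉ S := fun h => by simpa using hS h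
      refine ⟨insert n S, Finset.insert_subset (by simp) (hS.trans hmono), ?_⟩
      rwa [Finset.prod_insert hnS, ← mul_assoc]
    · obtain ⟨S, hS, h⟩ := ih e _ hε (by simpa using hu)
      exact ⟨S, hS.trans hmono, h⟩

-- Otherwise dₙ times a product of earlier dᵢ would be a square in K, yet its order at vₙ is odd.
open WithZero in
lemma notMem_iSup_adjoin_of_valuation [NumberField K] [CharZero L] {z : ℕ → L} {d : ℕ → K}
    (hz : ∀ n, z n ^ 2 = algebraMap K L (d n)) {v : ℕ → HeightOneSpectrum (𝓞 K)}
    (h3 : ∀ n, (v n).valuation K (d n) = exp (3 : ℤ))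
    (h1 : ∀ m n, m < n → (v n).valuation K (d m) = 1) (n : ℕ) :
    z n ∉ ⨆ i : Fin n, IntermediateField.adjoin K {z i} := by
  intro hmem
  obtain ⟨S, hS, a, ha⟩ := exists_isSquare_mul_prod_of_mem_iSup_adjoin hz n _ _ (hz n) hmem
  have h := congrArg ((v n).valuation K) ha
  rw [map_mul, h3, map_prod, Finset.prod_eq_one fun i hi => h1 i n (by simpa using hS hi),
    mul_one, map_mul] at h
  have h0 : (v n).valuation K a ≠ 0 := by
    intro h0
    rw [h0, mul_zero] at h
    exact exp_ne_zero h
  rw [← exp_log h0, ← exp_add, exp_inj] at h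
  omega

lemma finrank_adjoin_eq_two {z : L} {d : K} (hz : z ^ 2 = algebraMap K L d)
    (hmem : z ∉ (⊥ : IntermediateField K L)) :
    Module.finrank K (IntermediateField.adjoin K {z}) = 2 := by
  have hroot : Polynomial.aeval z (Polynomial.X ^ 2 - Polynomial.C d) = 0 := by
    simp [hz]
  have hmonic : (Polynomial.X ^ 2 - Polynomial.C d).Monic :=
    Polynomial.monic_X_pow_sub_C d two_ne_zero
  have hint : IsIntegral K z := ⟨_, hmonic, by simpa [Polynomial.aeval_def] using hroot⟩
  rw [IntermediateField.adjoin.finrank hint]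
  refine le_antisymm ?_ ((minpoly.two_le_natDegree_iff hint).mpr fun h =>
    hmem (IntermediateField.mem_bot.mpr h))
  have := Polynomial.natDegree_le_of_dvd (minpoly.dvd K z hroot) hmonic.ne_zero
  rwa [Polynomial.natDegree_X_pow_sub_C] at this

/-- A quadratic extension in characteristic 0 is Galois, so trivial intersection suffices; having
prime degree, it meets F trivially unless it is contained in F. -/
lemma linearDisjoint_adjoin_of_sq_eq [CharZero K] {z : L} {d : K} (hz : z ^ 2 = algebraMap K L d)
    {F : IntermediateField K L} [FiniteDimensional K F] (hmem : z ∉ F) :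
    (IntermediateField.adjoin K {z}).LinearDisjoint F := by
  have h2 := finrank_adjoin_eq_two hz fun h => hmem ((bot_le : ⊥ ≤ F) h)
  have : Algebra.IsQuadraticExtension K (IntermediateField.adjoin K {z}) := ⟨h2⟩
  have hle : IntermediateField.adjoin K {z} ⊓ F = ⊥ := by
    have hlt : IntermediateField.adjoin K {z} ⊓ F ≠ IntermediateField.adjoin K {z} := fun h =>
      hmem (inf_eq_left.mp h (IntermediateField.mem_adjoin_simple_self K z))
    have hdvd := IntermediateField.finrank_dvd_of_le_right
      (inf_le_left : IntermediateField.adjoin K {z} ⊓ F ≤ _)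
    rw [h2, Nat.dvd_prime Nat.prime_two] at hdvd
    rcases hdvd with h | h
    · exact IntermediateField.finrank_eq_one_iff.mp h
    · exact absurd (IntermediateField.eq_of_le_of_finrank_eq inf_le_left (h.trans h2.symm)) hlt
  exact IntermediateField.LinearDisjoint.of_inf_eq_bot hle

lemma adjoin_le_maxAbelianExtension [CharZero K] {z : L} {d : K} (hz : z ^ 2 = algebraMap K L d)
    (hmem : z ∉ (⊥ : IntermediateField K L)) :
    IntermediateField.adjoin K {z} ≤ maxAbelianExtension K L := by
  have : Algebra.IsQuadraticExtension K (IntermediateField.adjoin K {z}) :=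
    ⟨finrank_adjoin_eq_two hz hmem⟩
  exact le_sSup (IsAbelianGalois.of_isCyclic _ _ : IsAbelianGalois K _)

lemma exists_algEquiv_apply_eq_neg [CharZero K] [IsAlgClosure K L] {F : IntermediateField K L}
    {z : L} (hz : z ^ 2 ∈ F) (hmem : z ∉ F) :
    ∃ τ : L ≃ₐ[K] L, (∀ a ∈ F, τ a = a) ∧ τ z = -z := by
  have := IsAlgClosure.isAlgClosed K (K := L)
  have := IsAlgClosure.isAlgebraic (R := K) (K := L)
  have : IsGalois K L := IsAlgClosure.isGalois K L
  have hfix : ¬ ∀ τ : L ≃ₐ[F] L, τ z = z := by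
    rw [← InfiniteGalois.mem_bot_iff_fixed, IntermediateField.mem_bot]
    rintro ⟨a, rfl⟩
    exact hmem a.2
  push Not at hfix
  obtain ⟨τ, hτ⟩ := hfix
  refine ⟨τ.restrictScalars K, fun a ha => τ.commutes ⟨a, ha⟩, ?_⟩
  refine (sq_eq_sq_iff_eq_or_eq_neg.mp ?_).resolve_left hτ
  rw [← map_pow]
  exact τ.commutes ⟨_, hz⟩

end Kummer

lemma linearIndependent_int_of_flips {A : Type*} [AddCommGroup A] {P : ℕ → A}
    (hP : ∀ n, ¬ IsOfFinAddOrder (P n)) (f : ℕ → A →+ A) (hfix : ∀ m n, m < n → f n (P m) = P m)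
    (hflip : ∀ n, f n (P n) = -P n) : LinearIndependent ℤ P := by
  rw [linearIndependent_iff]
  intro l hl
  by_contra h0
  have hne : l.support.Nonempty := Finsupp.support_nonempty_iff.mpr h0
  set n := l.support.max' hne with hn
  have hnl : n ∈ l.support := l.support.max'_mem hne
  rw [Finsupp.linearCombination_apply, Finsupp.sum] at hl
  have hl' := congrArg (f n) hl
  rw [map_sum, map_zero] at hl'
  -- With n the top index of the relation, 1 - f n kills every term below n and doubles the n-th.
  have hsub : ∑ m ∈ l.support, (l m • P m - f n (l m • P m)) = 0 := by
    rw [Finset.sum_sub_distrib, hl, hl', sub_zero]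
  rw [Finset.sum_eq_single_of_mem n hnl fun m hm hmn => by
    rw [map_zsmul, hfix m n (lt_of_le_of_ne (l.support.le_max' m hm) hmn), sub_self],
    map_zsmul, hflip, smul_neg, sub_neg_eq_add, ← add_smul] at hsub
  refine hP n (isOfFinAddOrder_iff_zsmul_eq_zero.mpr ⟨l n + l n, ?_, hsub⟩)
  have := Finsupp.mem_support_iff.mp hnl
  omega

/-! ### Points with x-coordinate in K, and their doubles. -/

open WeierstrassCurve.Affine

namespace WeierstrassCurve

variable {K L : Type*} [Field K] [Field L] [Algebra K L] (W : WeierstrassCurve K)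

lemma baseChange_toAffine_a₁ : (W.baseChange L).toAffine.a₁ = algebraMap K L W.a₁ :=
  rfl

lemma baseChange_toAffine_a₂ : (W.baseChange L).toAffine.a₂ = algebraMap K L W.a₂ :=
  rfl

lemma baseChange_toAffine_a₃ : (W.baseChange L).toAffine.a₃ = algebraMap K L W.a₃ :=
  rfl

lemma baseChange_toAffine_a₄ : (W.baseChange L).toAffine.a₄ = algebraMap K L W.a₄ :=
  rfl

lemma baseChange_toAffine_a₆ : (W.baseChange L).toAffine.a₆ = algebraMap K L W.a₆ :=
  rfl

variable {W} in
lemma sq_eq_twoTorsionEval {x : K} {y : L}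
    (h : (W.baseChange L).toAffine.Equation (algebraMap K L x) y) :
    (2 * y + algebraMap K L W.a₁ * algebraMap K L x + algebraMap K L W.a₃) ^ 2 =
      algebraMap K L (W.twoTorsionEval x) := by
  rw [equation_iff] at h
  simp only [baseChange_toAffine_a₁, baseChange_toAffine_a₂, baseChange_toAffine_a₃,
    baseChange_toAffine_a₄, baseChange_toAffine_a₆] at h
  simp only [twoTorsionEval, b₂, b₄, b₆, map_add, map_mul, map_pow, map_ofNat]
  linear_combination 4 * h

lemma nonsingular_of_sq_eq_twoTorsionEval [CharZero L] {x : K} {y z : L} (hz0 : z ≠ 0)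
    (hz : z ^ 2 = algebraMap K L (W.twoTorsionEval x))
    (hy : 2 * y + algebraMap K L W.a₁ * algebraMap K L x + algebraMap K L W.a₃ = z) :
    (W.baseChange L).toAffine.Nonsingular (algebraMap K L x) y := by
  rw [nonsingular_iff, equation_iff]
  simp only [baseChange_toAffine_a₁, baseChange_toAffine_a₂, baseChange_toAffine_a₃,
    baseChange_toAffine_a₄, baseChange_toAffine_a₆]
  refine ⟨?_, .inr fun h => hz0 (by rw [← hy]; linear_combination h)⟩
  simp only [twoTorsionEval, b₂, b₄, b₆, map_add, map_mul, map_pow, map_ofNat] at hz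
  rw [← hy] at hz
  linear_combination (1 / 4) * hz

variable {W} {Γ₀ : Type*} [LinearOrderedCommGroupWithZero Γ₀] {w : Valuation K Γ₀} [DecidableEq L]

/-- The x-coordinate of the double is a rational function of x alone, so it stays in K and w need
not be extended to L. -/
lemma Dominates.exists_add_self_eq {x : K} (hx : W.Dominates w x) (w2 : w 2 < 1) {y : L}
    (h : (W.baseChange L).toAffine.Nonsingular (algebraMap K L x) y) :
    ∃ (x' : K) (y' : L) (h' : (W.baseChange L).toAffine.Nonsingular (algebraMap K L x') y'),
      W.Dominates w x' ∧ w x < w x' ∧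
        Point.some (algebraMap K L x) y h + Point.some (algebraMap K L x) y h =
          Point.some (algebraMap K L x') y' h' := by
  have hsq := sq_eq_twoTorsionEval h.1
  have hg : algebraMap K L (W.twoTorsionEval x) ≠ 0 :=
    (map_ne_zero _).mpr (hx.twoTorsionEval_ne_zero w2.le)
  have hz : 2 * y + algebraMap K L W.a₁ * algebraMap K L x + algebraMap K L W.a₃ ≠ 0 := by
    intro h0
    rw [h0] at hsq
    exact hg (by rw [← hsq]; ring)
  have hne : y ≠ (W.baseChange L).toAffine.negY (algebraMap K L x) y := by
    intro hy
    simp only [negY, baseChange_toAffine_a₁, baseChange_toAffine_a₃] at hy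
    exact hz (by linear_combination hy)
  have hadd := Point.add_self_of_Y_ne (h₁ := h) hne
  have hX : (W.baseChange L).toAffine.addX (algebraMap K L x) (algebraMap K L x)
      ((W.baseChange L).toAffine.slope (algebraMap K L x) (algebraMap K L x) y y) =
      algebraMap K L ((x ^ 4 - W.b₄ * x ^ 2 - 2 * W.b₆ * x - W.b₈) / W.twoTorsionEval x) := by
    have heq := (equation_iff ..).mp h.1
    rw [slope_of_Y_ne rfl hne, map_div₀, ← hsq]
    simp only [addX, negY, baseChange_toAffine_a₁, baseChange_toAffine_a₂,
      baseChange_toAffine_a₃, baseChange_toAffine_a₄, baseChange_toAffine_a₆] at heq ⊢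
    have hden : y - (-y - algebraMap K L W.a₁ * algebraMap K L x - algebraMap K L W.a₃) =
        2 * y + algebraMap K L W.a₁ * algebraMap K L x + algebraMap K L W.a₃ := by ring
    rw [hden]
    simp only [b₄, b₆, b₈, map_add, map_sub, map_mul, map_pow, map_ofNat]
    rw [eq_div_iff (pow_ne_zero 2 hz)]
    generalize algebraMap K L x = X at *
    set z := 2 * y + algebraMap K L W.a₁ * X + algebraMap K L W.a₃ with hzdef
    have hexp (n a₁ a₂ : L) : ((n / z) ^ 2 + a₁ * (n / z) - a₂ - X - X) * z ^ 2 =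
        n ^ 2 + a₁ * n * z - (a₂ + 2 * X) * z ^ 2 := by
      field_simp
      ring
    rw [hexp, hzdef]
    -- The multiplier of the curve equation is -(b₂ + 8x).
    linear_combination
      (-(algebraMap K L W.a₁ ^ 2 + 4 * algebraMap K L W.a₂ + 8 * X)) * heq
  have key : ∀ (X' Y' : L) (h' : (W.baseChange L).toAffine.Nonsingular X' Y') (x' : K),
      X' = algebraMap K L x' → ∃ h'' : (W.baseChange L).toAffine.Nonsingular (algebraMap K L x') Y',
        Point.some X' Y' h' = Point.some (algebraMap K L x') Y' h'' := by
    rintro _ Y' h' x' rfl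
    exact ⟨h', rfl⟩
  have hlt := hx.lt_valuation_duplication w2
  obtain ⟨h'', e⟩ := key _ _ _ _ hX
  exact ⟨_, _, h'', hx.of_lt hlt, hlt, hadd.trans e⟩

lemma Dominates.not_isOfFinAddOrder {x : K} (hx : W.Dominates w x) (w2 : w 2 < 1) {y : L}
    (h : (W.baseChange L).toAffine.Nonsingular (algebraMap K L x) y) :
    ¬ IsOfFinAddOrder (Point.some (algebraMap K L x) y h) := by
  intro hfin
  set P := Point.some (algebraMap K L x) y h with hP
  let A := {a : K × L // W.Dominates w a.1 ∧
    (W.baseChange L).toAffine.Nonsingular (algebraMap K L a.1) a.2}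
  let pt (a : A) : (W.baseChange L).toAffine.Point := Point.some _ _ a.2.2
  have hstep (a : A) : ∃ b : A, w a.1.1 < w b.1.1 ∧ pt a + pt a = pt b := by
    obtain ⟨x', y', h', h1, h2, h3⟩ := a.2.1.exists_add_self_eq w2 a.2.2
    exact ⟨⟨(x', y'), h1, h'⟩, h2, h3⟩
  choose dbl hlt hdbl using hstep
  let s (k : ℕ) : A := dbl^[k] ⟨(x, y), hx, h⟩
  have hs (k : ℕ) : s (k + 1) = dbl (s k) := Function.iterate_succ_apply' ..
  have hpt (k : ℕ) : 2 ^ k • P = pt (s k) := by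
    induction k with
    | zero => exact one_nsmul P
    | succ k ih => rw [pow_succ, mul_nsmul, two_nsmul, ih, hdbl, ← hs]
  -- The points 2ᵏP have x-coordinates of strictly increasing valuation, so P has infinitely many
  -- multiples.
  have hmono : StrictMono fun k => w (s k).1.1 :=
    strictMono_nat_of_lt_succ fun k => by rw [hs]; exact hlt _
  have hinj : Function.Injective fun k : ℕ => 2 ^ k • P := by
    intro k m hkm
    refine hmono.injective ?_
    simp only [hpt] at hkm
    have : algebraMap K L (s k).1.1 = algebraMap K L (s m).1.1 := (Point.some.inj hkm).1
    exact congrArg w ((algebraMap K L).injective this)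
  have hfinite : (AddSubmonoid.multiples P : Set (W.baseChange L).toAffine.Point).Finite := by
    rwa [finite_multiples]
  refine Set.infinite_of_injective_forall_mem hinj (fun k => ?_) hfinite
  exact nsmul_mem (AddSubmonoid.mem_multiples P) _

end WeierstrassCurve

/-! ### Linear independence of the points by Galois sign changes. -/

section Independence

open WeierstrassCurve

variable {K Kbar : Type*} [Field K] [CharZero K] [Field Kbar] [Algebra K Kbar]
  [IsAlgClosure K Kbar] [DecidableEq Kbar] {W : WeierstrassCurve K} {Γ₀ : Type*}
  [LinearOrderedCommGroupWithZero Γ₀] {w : Valuation K Γ₀}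

lemma linearIndependent_points_of_notMem_iSup (w2 : w 2 < 1) {x : ℕ → K} {z : ℕ → Kbar}
    (hx : ∀ n, W.Dominates w (x n))
    (hz : ∀ n, z n ^ 2 = algebraMap K Kbar (W.twoTorsionEval (x n)))
    (hmem : ∀ n, z n ∉ ⨆ i : Fin n, IntermediateField.adjoin K {z i})
    {F : IntermediateField K Kbar} [DecidableEq F] {y : ℕ → F}
    (hy : ∀ n, 2 * (y n : Kbar) + algebraMap K Kbar W.a₁ * algebraMap K Kbar (x n) +
      algebraMap K Kbar W.a₃ = z n)
    {P : ℕ → (W.baseChange F).toAffine.Point}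
    (hP : ∀ n, ∃ h, P n = Point.some (algebraMap K F (x n)) (y n) h) :
    LinearIndependent ℤ P := by
  have : CharZero Kbar := charZero_of_injective_algebraMap (algebraMap K Kbar).injective
  choose h hP using hP
  let φ : (W.baseChange F).toAffine.Point →+ (W.baseChange Kbar).toAffine.Point :=
    Point.map F.val
  have hns (n : ℕ) : (W.baseChange Kbar).toAffine.Nonsingular (algebraMap K Kbar (x n)) (y n) :=
    (Affine.baseChange_nonsingular W F.val.injective _ _).mpr (h n)
  have hφ (n : ℕ) : φ (P n) = Point.some (algebraMap K Kbar (x n)) (y n : Kbar) (hns n) := by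
    rw [hP]
    rfl
  have hτ (n : ℕ) := exists_algEquiv_apply_eq_neg
    (F := ⨆ i : Fin n, IntermediateField.adjoin K {z i})
    (hz n ▸ IntermediateField.algebraMap_mem _ _) (hmem n)
  choose τ hτfix hτflip using hτ
  let f (n : ℕ) : (W.baseChange Kbar).toAffine.Point →+ (W.baseChange Kbar).toAffine.Point :=
    Point.map (τ n).toAlgHom
  have hf (n m : ℕ) : ∃ h', f n (φ (P m)) =
      Point.some (algebraMap K Kbar (x m)) (τ n (y m : Kbar)) h' := by
    have h' := (Affine.baseChange_nonsingular W (τ n).toAlgHom.injective _ _).mpr (hns m)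
    rw [hφ]
    have key : ∀ (X Y : Kbar) (h₀ : (W.baseChange Kbar).toAffine.Nonsingular X Y) (X' : Kbar),
        X = X' → ∃ h₁ : (W.baseChange Kbar).toAffine.Nonsingular X' Y,
          Point.some X Y h₀ = Point.some X' Y h₁ := by
      rintro X Y h₀ _ rfl
      exact ⟨h₀, rfl⟩
    exact key _ _ h' _ ((τ n).commutes (x m))
  -- The automorphisms τ n need not preserve F, so independence is proved after mapping the points
  -- to Kbar.
  refine LinearIndependent.of_comp φ.toIntLinearMap (linearIndependent_int_of_flips
    (fun n => ?_) f (fun m n hmn => ?_) fun n => ?_)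
  · change ¬ IsOfFinAddOrder (φ (P n))
    rw [hφ]
    exact (hx n).not_isOfFinAddOrder w2 (hns n)
  · change f n (φ (P m)) = φ (P m)
    obtain ⟨h', e⟩ := hf n m
    have hzm : τ n (z m) = z m := hτfix n _ (le_iSup (fun i : Fin n =>
      IntermediateField.adjoin K {z i}) ⟨m, hmn⟩ (IntermediateField.mem_adjoin_simple_self K _))
    have : τ n (y m : Kbar) = y m := by
      have := hy m ▸ hzm
      simp only [map_add, map_mul, map_ofNat, AlgEquiv.commutes] at this
      exact mul_left_cancel₀ two_ne_zero (by linear_combination this)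
    rw [e, hφ, Point.some.injEq]
    exact ⟨rfl, this⟩
  · change f n (φ (P n)) = -φ (P n)
    obtain ⟨h', e⟩ := hf n n
    have hzn := hτflip n
    rw [← hy n] at hzn
    simp only [map_add, map_mul, map_ofNat, AlgEquiv.commutes] at hzn
    rw [e, hφ, Point.neg_some, Point.some.injEq]
    refine ⟨rfl, ?_⟩
    simp only [negY, baseChange_toAffine_a₁, baseChange_toAffine_a₃]
    exact mul_left_cancel₀ two_ne_zero (by linear_combination hzn)

lemma exists_linearIndependent_points (w2 : w 2 < 1) {x : ℕ → K} {z : ℕ → Kbar}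
    (hx : ∀ n, W.Dominates w (x n))
    (hz : ∀ n, z n ^ 2 = algebraMap K Kbar (W.twoTorsionEval (x n)))
    (hmem : ∀ n, z n ∉ ⨆ i : Fin n, IntermediateField.adjoin K {z i})
    {F : IntermediateField K Kbar} [DecidableEq F] (hzF : ∀ n, z n ∈ F) :
    ∃ (y : ℕ → F) (P : ℕ → (W.baseChange F).toAffine.Point),
      (∀ n, 2 * (y n : Kbar) + algebraMap K Kbar W.a₁ * algebraMap K Kbar (x n) +
        algebraMap K Kbar W.a₃ = z n) ∧
      (∀ n, ∃ h, P n = Point.some (algebraMap K F (x n)) (y n) h) ∧ LinearIndependent ℤ P := by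
  have : CharZero F := charZero_of_injective_algebraMap (algebraMap K F).injective
  let zF (n : ℕ) : F := ⟨z n, hzF n⟩
  let y (n : ℕ) : F := (zF n - algebraMap K F W.a₁ * algebraMap K F (x n) - algebraMap K F W.a₃) / 2
  have hyF (n : ℕ) : 2 * y n + algebraMap K F W.a₁ * algebraMap K F (x n) +
      algebraMap K F W.a₃ = zF n := by
    simp only [y]
    ring
  have hzF2 (n : ℕ) : zF n ^ 2 = algebraMap K F (W.twoTorsionEval (x n)) := Subtype.ext (hz n)
  have hz0 (n : ℕ) : zF n ≠ 0 := by
    intro h0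
    refine hmem n ?_
    rw [show z n = 0 from congrArg Subtype.val h0]
    exact zero_mem _
  have hy (n : ℕ) : 2 * (y n : Kbar) + algebraMap K Kbar W.a₁ * algebraMap K Kbar (x n) +
      algebraMap K Kbar W.a₃ = z n := congrArg (Subtype.val : F → Kbar) (hyF n)
  have hP (n : ℕ) : ∃ h, Point.some (algebraMap K F (x n)) (y n)
      (W.nonsingular_of_sq_eq_twoTorsionEval (hz0 n) (hzF2 n) (hyF n)) =
      Point.some (algebraMap K F (x n)) (y n) h := ⟨_, rfl⟩
  exact ⟨y, _, hy, hP, linearIndependent_points_of_notMem_iSup w2 hx hz hmem hy hP⟩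

end Independence

/-! ### Assembly over the number field. -/

section NumberField

variable {K Kbar : Type*} [Field K] [NumberField K] [Field Kbar] [Algebra K Kbar]
  [IsAlgClosure K Kbar]

lemma exists_seq_sqrt_mem_abFixedFieldOf (W : WeierstrassCurve K) {σ : Kbar ≃ₐ[K] Kbar}
    (hσ : orderOf σ = 2) :
    ∃ (w : HeightOneSpectrum (𝓞 K)) (x : ℕ → K) (z : ℕ → Kbar), w.valuation K 2 < 1 ∧
      (∀ n, W.Dominates (w.valuation K) (x n)) ∧
      (∀ n, z n ^ 2 = algebraMap K Kbar (W.twoTorsionEval (x n))) ∧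
      (∀ n, z n ∉ ⨆ i : Fin n, IntermediateField.adjoin K {z i}) ∧
      ∀ n, z n ∈ abFixedFieldOf σ := by
  have := IsAlgClosure.isAlgClosed K (K := Kbar)
  have : CharZero Kbar := charZero_of_injective_algebraMap (algebraMap K Kbar).injective
  obtain ⟨w, hw⟩ := exists_place_valuation_lt_one (K := K) Nat.prime_two
  obtain ⟨x, v, h1, h2, h3, h4⟩ := exists_seq_dominates_valuation_twoTorsionEval W (squareCone hσ)
    (sq_mem_squareCone hσ) (mem_or_neg_mem_squareCone hσ) (w := w) (by exact_mod_cast hw)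
  choose z hfix hz using fun n => mem_squareCone.mp (h1 n)
  have hmem := notMem_iSup_adjoin_of_valuation hz h3 h4
  refine ⟨w, x, z, by exact_mod_cast hw, h2, hz, hmem, fun n => ⟨?_, ?_⟩⟩
  · exact adjoin_le_maxAbelianExtension (hz n) (fun h => hmem n (SetLike.le_def.mp bot_le h))
      (IntermediateField.mem_adjoin_simple_self K _)
  · exact mem_fixedFieldOf_iff.mpr (hfix n)

end NumberField

lemma LinearIndependent.hasInfiniteRank {A : Type*} [AddCommGroup A] {P : ℕ → A}
    (hP : LinearIndependent ℤ P) : HasInfiniteRank A :=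
  hP.aleph0_le_rank

theorem mainTheorem4 {K Kbar : Type*} [Field K] [NumberField K] [Field Kbar] [Algebra K Kbar]
    [IsAlgClosure K Kbar] [DecidableEq Kbar]
    (E : WeierstrassCurve K) [E.IsElliptic]
    (σ : Kbar ≃ₐ[K] Kbar) (hσ : orderOf σ = 2) :
    HasInfiniteRank (E.baseChange (abFixedFieldOf σ)).toAffine.Point ∧
    HasInfiniteRank (E.baseChange (fixedFieldOf σ)).toAffine.Point ∧
    ∀ (C : WeierstrassCurve.VariableChange K) (a b : K), C • E = shortWeierstrass a b →
      ∃ (x : ℕ → K) (y : ℕ → abFixedFieldOf σ)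
        (P : ℕ → ((shortWeierstrass a b).baseChange (abFixedFieldOf σ)).toAffine.Point),
        (∀ i, y i ^ 2 = algebraMap K (abFixedFieldOf σ) (x i ^ 3 + a * x i + b)) ∧
        (∀ i, Module.finrank K (IntermediateField.adjoin K {(y i : Kbar)}) = 2) ∧
        (∀ n, (IntermediateField.adjoin K {(y n : Kbar)}).LinearDisjoint
          (⨆ i : Fin n, IntermediateField.adjoin K {(y i : Kbar)} : IntermediateField K Kbar)) ∧
        (∀ i, ∃ h, P i =
          WeierstrassCurve.Affine.Point.some (algebraMap K (abFixedFieldOf σ) (x i)) (y i) h) ∧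
        LinearIndependent ℤ P := by
  -- Stated for every larger F, so that both rank claims follow at once.
  have hrank (F : IntermediateField K Kbar) (hF : abFixedFieldOf σ ≤ F) :
      HasInfiniteRank (E.baseChange F).toAffine.Point := by
    obtain ⟨w, x, z, w2, hx, hz, hmem, hzF⟩ := exists_seq_sqrt_mem_abFixedFieldOf E hσ
    obtain ⟨_, P, -, -, hP⟩ :=
      exists_linearIndependent_points w2 hx hz hmem (F := F) fun n => hF (hzF n)
    exact hP.hasInfiniteRank
  refine ⟨hrank _ le_rfl, hrank _ inf_le_right, fun _ a b _ => ?_⟩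
  have : CharZero Kbar := charZero_of_injective_algebraMap (algebraMap K Kbar).injective
  have : CharZero (abFixedFieldOf σ) :=
    charZero_of_injective_algebraMap (algebraMap K (abFixedFieldOf σ)).injective
  obtain ⟨w, x, z, w2, hx, hz, hmem, hzF⟩ :=
    exists_seq_sqrt_mem_abFixedFieldOf (shortWeierstrass a b) hσ
  obtain ⟨y, P, hy, hP, hli⟩ := exists_linearIndependent_points w2 hx hz hmem hzF
  -- Here a₁ = a₃ = 0, so yₙ and zₙ differ by a factor 2 and generate the same quadratic field.
  have hyz (n : ℕ) : z n = 2 * (y n : Kbar) := by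
    rw [← hy n]
    simp [shortWeierstrass]
  have hadj (n : ℕ) : IntermediateField.adjoin K {(y n : Kbar)} =
      IntermediateField.adjoin K {z n} := by
    refine le_antisymm ?_ ?_ <;>
      rw [IntermediateField.adjoin_le_iff, Set.singleton_subset_iff, SetLike.mem_coe]
    · rw [show (y n : Kbar) = z n / 2 by rw [hyz]; ring]
      exact div_mem (IntermediateField.mem_adjoin_simple_self K _) (ofNat_mem _ 2)
    · rw [hyz]
      exact mul_mem (ofNat_mem _ 2) (IntermediateField.mem_adjoin_simple_self K _)
  refine ⟨x, y, P, fun n => ?_, fun n => ?_, fun n => ?_, hP, hli⟩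
  · have h := hz n
    rw [hyz] at h
    refine Subtype.ext (mul_left_cancel₀ (show (4 : Kbar) ≠ 0 by norm_num) ?_)
    simp only [WeierstrassCurve.twoTorsionEval, WeierstrassCurve.b₂, WeierstrassCurve.b₄,
      WeierstrassCurve.b₆, shortWeierstrass] at h
    calc (4 : Kbar) * (y n : Kbar) ^ 2 = (2 * (y n : Kbar)) ^ 2 := by ring
      _ = algebraMap K Kbar (4 * (x n ^ 3 + a * x n + b)) := by rw [h]; congr 1; ring
      _ = 4 * algebraMap K Kbar (x n ^ 3 + a * x n + b) := by rw [map_mul, map_ofNat]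
  · rw [hadj]
    exact finrank_adjoin_eq_two (hz n) fun h => hmem n (SetLike.le_def.mp bot_le h)
  · rw [hadj, iSup_congr fun i : Fin n => hadj i]
    have (i : Fin n) : FiniteDimensional K (IntermediateField.adjoin K {z i}) :=
      IntermediateField.adjoin.finiteDimensional (Algebra.IsIntegral.isIntegral _)
    exact linearDisjoint_adjoin_of_sq_eq (hz n) (hmem n)
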